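/- A real homogeneous polynomial $f(x,y)$ of degree $D$ is called hyperbolic if $f_{xx}f_{yy}-f_{xy}^2<0$ at every point of $\mathbb{R}^2\setminus\{(0,0)\}$. For such an $f$ let $\gamma_f:[0,2\pi]\to\mathbb{R}^3$ be the closed curve of second fundamental forms $\gamma_f(\varphi)=(a,b,c)(\varphi)=(f_{xx},f_{xy},f_{yy})(\cos\varphi,\sin\varphi)$. Its index $\mathrm{Ind}(\gamma_f)\in\mathbb{Z}$ is the number of revolutions about the cone $\{ac-b^2=0\}$, that is, $\frac1{2\pi}$ times the total variation over $[0,2\pi]$ of a continuous determination of $\arg\big(a-c+2bi\big)(\varphi)$. **Theorem.** Let $n\ge 1$ and $k\ge 1$ be integers. (i) If $n\ge 2$, then $g_{2n+2}(x,y)=(x^2-y^2)(x^{2n}+y^{2n})$, of degree $2n+2$, is hyperbolic and $\mathrm{Ind}(\gamma_{g_{2n+2}})=0$. (ii) If $(n,k)\neq(1,1)$, then $f_{2k+1}(x,y)=x\,(x^{2n}+y^{2n})\prod_{i=1}^{k}(x^2-i^2y^2)$, of degree $2n+2k+1$, is hyperbolic and $\mathrm{Ind}(\gamma_{f_{2k+1}})=2-2k-1$.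 (iii) The polynomial $f_{2k+2}(x,y)=x\,(x^{2n}+y^{2n})\,\big(x-(k+1)y\big)\prod_{i=1}^{k}(x^2-i^2y^2)$, of degree $2n+2k+2$, is hyperbolic and $\mathrm{Ind}(\gamma_{f_{2k+2}})=2-2k-2$. -/

import Mathlib

/-- Real polynomials in two variables; `X 0` is `x` and `X 1` is `y`. -/
abbrev RealPoly2 : Type := MvPolynomial (Fin 2) ℝ

/-- The Hessian polynomial `f_xx f_yy - f_xy ^ 2`. -/
noncomputable def hessPoly (f : RealPoly2) : RealPoly2 :=
  MvPolynomial.pderiv 0 (MvPolynomial.pderiv 0 f) * MvPolynomial.pderiv 1 (MvPolynomial.pderiv 1 f)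
    - MvPolynomial.pderiv 0 (MvPolynomial.pderiv 1 f) ^ 2

/-- `f` belongs to `Hyp(D)`: it is homogeneous of degree `D` and its Hessian polynomial is negative
at every point of the plane other than the origin (in particular `f ≠ 0`). -/
def IsHyperbolicForm (D : ℕ) (f : RealPoly2) : Prop :=
  f.IsHomogeneous D ∧ ∀ v : Fin 2 → ℝ, v ≠ 0 → MvPolynomial.eval v (hessPoly f) < 0

/-- The real quadratic form `a ξ² + 2 b ξ η + c η²` on the plane is the triple `(a, b, c)`. -/
abbrev QuadForm2 : Type := ℝ × ℝ × ℝ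

/-- A continuous curve `[0, 2π] → 𝒬` of forms of signature `(+, -)`, i.e. `a c - b² < 0`. -/
def IsHyperbolicCurve (γ : ℝ → QuadForm2) : Prop :=
  ContinuousOn γ (Set.Icc 0 (2 * Real.pi)) ∧
    ∀ φ ∈ Set.Icc 0 (2 * Real.pi), (γ φ).1 * (γ φ).2.2 - (γ φ).2.1 ^ 2 < 0

/-- The complex number `a - c + 2 b i` attached to the form `(a, b, c)`. -/
def formToComplex (q : QuadForm2) : ℂ := ⟨q.1 - q.2.2, 2 * q.2.1⟩

/-- `γ` is a hyperbolic curve of index `m`: there is a continuous determination `θ` on `[0, 2π]` of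
the argument of `a - c + 2 b i` along `γ`, and `(θ (2π) - θ 0) / (2π) = m`. -/
def HasIndex (γ : ℝ → QuadForm2) (m : ℤ) : Prop :=
  IsHyperbolicCurve γ ∧ ∃ θ : ℝ → ℝ, ContinuousOn θ (Set.Icc 0 (2 * Real.pi)) ∧
    (∀ φ ∈ Set.Icc 0 (2 * Real.pi), formToComplex (γ φ) =
      (‖formToComplex (γ φ)‖ : ℂ) * Complex.exp ((θ φ : ℂ) * Complex.I)) ∧
    (θ (2 * Real.pi) - θ 0) / (2 * Real.pi) = m

/-- The curve `γ_f`: the second fundamental form `(f_xx, f_xy, f_yy)` of `f` at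
`(cos φ, sin φ)`. -/
noncomputable def secondFormCurve (f : RealPoly2) (φ : ℝ) : QuadForm2 :=
  (MvPolynomial.eval ![Real.cos φ, Real.sin φ] (MvPolynomial.pderiv 0 (MvPolynomial.pderiv 0 f)),
    MvPolynomial.eval ![Real.cos φ, Real.sin φ] (MvPolynomial.pderiv 0 (MvPolynomial.pderiv 1 f)),
    MvPolynomial.eval ![Real.cos φ, Real.sin φ] (MvPolynomial.pderiv 1 (MvPolynomial.pderiv 1 f)))

/-- `g_{2n+2} = (x² - y²) (x^{2n} + y^{2n})`. -/
noncomputable def gForm (n : ℕ) : RealPoly2 :=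
  (MvPolynomial.X 0 ^ 2 - MvPolynomial.X 1 ^ 2) *
    (MvPolynomial.X 0 ^ (2 * n) + MvPolynomial.X 1 ^ (2 * n))

/-- `∏_{i=1}^k (x² - i² y²)`. -/
noncomputable def linesProd (k : ℕ) : RealPoly2 :=
  ∏ i ∈ Finset.Icc 1 k, (MvPolynomial.X 0 ^ 2 - MvPolynomial.C ((i : ℝ) ^ 2) * MvPolynomial.X 1 ^ 2)

/-- `f_{2k+1} = x (x^{2n} + y^{2n}) ∏_{i=1}^k (x² - i² y²)`. -/
noncomputable def fOddForm (n k : ℕ) : RealPoly2 :=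
  MvPolynomial.X 0 * (MvPolynomial.X 0 ^ (2 * n) + MvPolynomial.X 1 ^ (2 * n)) * linesProd k

/-- `f_{2k+2} = x (x^{2n} + y^{2n}) (x - (k+1) y) ∏_{i=1}^k (x² - i² y²)`. -/
noncomputable def fEvenForm (n k : ℕ) : RealPoly2 :=
  MvPolynomial.X 0 * (MvPolynomial.X 0 ^ (2 * n) + MvPolynomial.X 1 ^ (2 * n)) *
    (MvPolynomial.X 0 - MvPolynomial.C ((k : ℝ) + 1) * MvPolynomial.X 1) * linesProd k

/-- On a hyperbolic curve `a - c + 2 b i` never vanishes. -/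
theorem IsHyperbolicCurve.formToComplex_ne_zero {γ : ℝ → QuadForm2} (h : IsHyperbolicCurve γ)
    {φ : ℝ} (hφ : φ ∈ Set.Icc 0 (2 * Real.pi)) : formToComplex (γ φ) ≠ 0 := by
  intro h0
  have h1 := h.2 φ hφ
  have hre : (γ φ).1 - (γ φ).2.2 = 0 := congrArg Complex.re h0
  have him : 2 * (γ φ).2.1 = 0 := congrArg Complex.im h0
  have hb : (γ φ).2.1 = 0 := by linarith
  have ha : (γ φ).1 = (γ φ).2.2 := by linarith
  rw [hb, ha] at h1
  nlinarith [mul_self_nonneg (γ φ).2.2]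

/-- The index of a curve is unique. -/
theorem HasIndex.unique {γ : ℝ → QuadForm2} {m m' : ℤ} (h : HasIndex γ m) (h' : HasIndex γ m') :
    m = m' := by
  obtain ⟨hγ, θ, hc, he, hm⟩ := h
  obtain ⟨-, θ', hc', he', hm'⟩ := h'
  have hpi : (2 * Real.pi) ≠ 0 := by positivity
  have key : ∀ φ ∈ Set.Icc 0 (2 * Real.pi),
      (θ φ - θ' φ) / (2 * Real.pi) ∈ Set.range ((↑) : ℤ → ℝ) := by
    intro φ hφ
    have hne := hγ.formToComplex_ne_zero hφ
    have hn : (‖formToComplex (γ φ)‖ : ℂ) ≠ 0 := by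
      simpa using hne
    have hexp := mul_left_cancel₀ hn ((he φ hφ).symm.trans (he' φ hφ))
    obtain ⟨j, hj⟩ := Complex.exp_eq_exp_iff_exists_int.1 hexp
    refine ⟨j, ?_⟩
    have h2 := congrArg Complex.im hj
    simp at h2
    rw [h2]
    field_simp
    ring
  have hcont : ContinuousOn (fun φ => (θ φ - θ' φ) / (2 * Real.pi)) (Set.Icc 0 (2 * Real.pi)) :=
    (hc.sub hc').div_const _
  have h2pi : (0 : ℝ) ≤ 2 * Real.pi := by positivity
  have hconst := isPreconnected_Icc.constant_of_mapsTo
    Int.isClosedEmbedding_coe_real.isEmbedding.isDiscrete_range hcont key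
    (Set.left_mem_Icc.2 h2pi) (Set.right_mem_Icc.2 h2pi)
  have : (m : ℝ) = m' := by
    rw [← hm, ← hm']
    field_simp at hconst ⊢
    linarith
  exact_mod_cast this

/-! Both assertions are proved by adding one line at a time. Fix a form `f` of degree d ≥ 2.

Hyperbolicity. By Euler's identities, in a basis consisting of the point v and a vector w, the
Hessian matrix has entries d(d-1)f, (d-1)∂_w f and ∂_w² f. Off the line spanned by w, hyperbolicity
therefore reads d f ∂_w² f < (d-1)(∂_w f)². Take w along the zero line of a linear form l: ∂_w
treats l as a constant, so the condition for f·l is the same with d+1 for d, and it is weaker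
(`IsHyperbolicForm.mul_lineForm`).

Index. Let F be the restriction of `f` to the unit circle. In the frame rotating with φ, which
contributes 2 turns, a - c + 2bi stays within a right angle of F + iF'
(`IsHyperbolicForm.hasIndex`). A positive factor gives F + iF' winding number 0, and each new line
contributes -1 (`HasWinding.mul_lineForm`).

Starting points. For n ≥ 2 it is `gForm n`, whose hyperbolicity is an inequality between hyperbolic
cosines (`gForm_inequality`). For n = 1 the Hessian of x⁴ - y⁴ vanishes on the axes, and that of
x(x⁴ - y⁴) on y = 0, so hyperbolicity starts at the sextic `fEvenForm 1 1`, checked by sums of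
squares. -/

open MvPolynomial

/-! ### Euler's identities -/

/-- Euler's identity in two variables, evaluated at a point. -/
theorem MvPolynomial.IsHomogeneous.euler_eval {D : ℕ} {f : RealPoly2} (hf : f.IsHomogeneous D)
    (v : Fin 2 → ℝ) :
    v 0 * eval v (pderiv 0 f) + v 1 * eval v (pderiv 1 f) = D * eval v f := by
  have h := congrArg (eval v) hf.sum_X_mul_pderiv
  simpa [Fin.sum_univ_two] using h

theorem pderiv_one_pderiv_zero (f : RealPoly2) :
    pderiv 1 (pderiv 0 f) = pderiv 0 (pderiv 1 f) := by
  have h : ⁅(pderiv 1 : Derivation ℝ RealPoly2 RealPoly2),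
      (pderiv 0 : Derivation ℝ RealPoly2 RealPoly2)⁆ = 0 := by
    apply MvPolynomial.derivation_ext
    intro i
    fin_cases i <;> simp [Derivation.commutator_apply, pderiv_X]
  have h2 := congrArg (fun d : Derivation ℝ RealPoly2 RealPoly2 => d f) h
  simpa [Derivation.commutator_apply, sub_eq_zero] using h2

theorem MvPolynomial.IsHomogeneous.euler_eval_pderiv_zero {D : ℕ} {f : RealPoly2}
    (hf : f.IsHomogeneous D) (hD : 1 ≤ D) (v : Fin 2 → ℝ) :
    v 0 * eval v (pderiv 0 (pderiv 0 f)) + v 1 * eval v (pderiv 0 (pderiv 1 f))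
      = ((D : ℝ) - 1) * eval v (pderiv 0 f) := by
  have h := (hf.pderiv (i := 0)).euler_eval v
  rwa [pderiv_one_pderiv_zero, Nat.cast_sub hD, Nat.cast_one] at h

theorem MvPolynomial.IsHomogeneous.euler_eval_pderiv_one {D : ℕ} {f : RealPoly2}
    (hf : f.IsHomogeneous D) (hD : 1 ≤ D) (v : Fin 2 → ℝ) :
    v 0 * eval v (pderiv 0 (pderiv 1 f)) + v 1 * eval v (pderiv 1 (pderiv 1 f))
      = ((D : ℝ) - 1) * eval v (pderiv 1 f) := by
  have h := (hf.pderiv (i := 1)).euler_eval v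
  rwa [Nat.cast_sub hD, Nat.cast_one] at h

/-! ### Linear factors and hyperbolicity -/

/-- The linear form `x - r y`. -/
noncomputable def lineForm (r : ℝ) : RealPoly2 := X 0 - C r * X 1

theorem lineForm_isHomogeneous (r : ℝ) : (lineForm r).IsHomogeneous 1 :=
  (isHomogeneous_X ℝ 0).sub ((isHomogeneous_X ℝ 1).C_mul r)

theorem eval_lineForm (r : ℝ) (v : Fin 2 → ℝ) : eval v (lineForm r) = v 0 - r * v 1 := by
  simp [lineForm]

theorem pderiv_zero_lineForm (r : ℝ) : pderiv 0 (lineForm r) = 1 := by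
  simp [lineForm, pderiv_X]

theorem pderiv_one_lineForm (r : ℝ) : pderiv 1 (lineForm r) = -C r := by
  simp [lineForm, pderiv_X]

theorem eval_hessPoly (f : RealPoly2) (v : Fin 2 → ℝ) :
    eval v (hessPoly f) = eval v (pderiv 0 (pderiv 0 f)) * eval v (pderiv 1 (pderiv 1 f))
      - eval v (pderiv 0 (pderiv 1 f)) ^ 2 := by
  simp [hessPoly]

/-- Multiplying a hyperbolic form by a linear form that is not one of its factors gives a
hyperbolic form. -/
theorem IsHyperbolicForm.mul_lineForm {D : ℕ} {f : RealPoly2} (hf : IsHyperbolicForm D f)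
    (hD : 2 ≤ D) (r : ℝ)
    (hr : ∀ v : Fin 2 → ℝ, v ≠ 0 → v 0 = r * v 1 → eval v f ≠ 0) :
    IsHyperbolicForm (D + 1) (f * lineForm r) := by
  refine ⟨hf.1.mul (lineForm_isHomogeneous r), fun v hv => ?_⟩
  have e := hf.1.euler_eval v
  have e0 := hf.1.euler_eval_pderiv_zero (by omega) v
  have e1 := hf.1.euler_eval_pderiv_one (by omega) v
  have hneg := hf.2 v hv
  have hrv := hr v hv
  have hD' : (2 : ℝ) ≤ D := by exact_mod_cast hD
  rw [eval_hessPoly] at hneg ⊢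
  simp only [pderiv_mul, pderiv_zero_lineForm, pderiv_one_lineForm, map_add, map_mul, map_neg,
    eval_lineForm, eval_C, mul_one, pderiv_C, mul_zero, add_zero,
    neg_zero]
  generalize (D : ℝ) = d at *
  generalize eval v f = a at *
  generalize eval v (pderiv 0 f) = p at *
  generalize eval v (pderiv 1 f) = q at *
  generalize eval v (pderiv 0 (pderiv 0 f)) = A at *
  generalize eval v (pderiv 0 (pderiv 1 f)) = B at *
  generalize eval v (pderiv 1 (pderiv 1 f)) = E at *
  have hx : ∀ x y : ℝ, v 0 = x → v 1 = y → (x ≠ 0 ∨ y ≠ 0) := by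
    rintro x y rfl rfl
    by_contra! h
    exact hv (by ext i; fin_cases i <;> simp [h.1, h.2])
  specialize hx _ _ rfl rfl
  generalize v 0 = x at *
  generalize v 1 = y at *
  -- On the line itself the Hessian of the product is -(r p + q)², and Euler's identity d a = y (r p
  -- + q) keeps it nonzero.
  by_cases hl : x - r * y = 0
  · have hxy : x = r * y := by linarith
    have hy : y ≠ 0 := by
      rintro rfl
      simp [hxy] at hx
    have ha := hrv hxy
    have key : r * p + q ≠ 0 := by
      intro h
      have : d * a = 0 := by rw [← e, hxy]; linear_combination y * h
      rcases mul_eq_zero.1 this with h | h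
      · linarith
      · exact ha h
    rw [hl]
    have := sq_nonneg (q - r * p)
    have := sq_pos_of_ne_zero key
    nlinarith
  · set l := x - r * y with hldef
    have hl2 : 0 < l ^ 2 := by positivity
    -- derivatives in the direction `(r, 1)`, which `x - r y` annihilates
    set P := r * p + q with hP
    set Q := r ^ 2 * A + 2 * r * B + E with hQ
    have f2 : (d - 1) * P = r * (x * A + y * B) + (x * B + y * E) := by
      rw [hP]; linear_combination -r * e0 - e1
    -- The Hessian determinant in the basis v, w = (r, 1), whose determinant is l.
    have h1 : l ^ 2 * (A * E - B ^ 2) = (d - 1) * (d * a * Q - (d - 1) * P ^ 2) := by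
      have f1 : (d - 1) * d * a = x ^ 2 * A + 2 * x * y * B + y ^ 2 * E := by
        linear_combination -(d - 1) * e - x * e0 - y * e1
      rw [hldef, hQ]
      linear_combination -Q * f1 + ((d - 1) * P + (r * (x * A + y * B) + (x * B + y * E))) * f2
    have h2 : (d + 1) * a * Q - d * P ^ 2 < 0 := by
      have : d * a * Q - (d - 1) * P ^ 2 < 0 := by
        by_contra! h
        nlinarith [mul_nonneg (by linarith : (0:ℝ) ≤ d - 1) h]
      have h3 : d * ((d + 1) * a * Q - d * P ^ 2)
          = (d + 1) * (d * a * Q - (d - 1) * P ^ 2) - P ^ 2 := by ring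
      have h4 : d * ((d + 1) * a * Q - d * P ^ 2) < 0 := by
        rw [h3]; nlinarith [sq_nonneg P]
      by_contra! h
      nlinarith [mul_nonneg (by linarith : (0:ℝ) ≤ d) h]
    -- The identity `h1` for the product: degree d + 1, value a l, derivatives P l and Q l along w.
    -- A factor l² cancels.
    have h5 : (A * l + p + p) * (E * l + q * -r + q * -r) - (B * l + q + p * -r) ^ 2
       = d * ((d + 1) * a * Q - d * P ^ 2) := by
      rw [hldef] at h1 ⊢
      linear_combination h1 + 2 * Q * e + 2 * P * f2
    rw [← hldef] at *
    have : d * ((d + 1) * a * Q - d * P ^ 2) < 0 := mul_neg_of_pos_of_neg (by linarith) h2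
    linarith

/-! ### Winding numbers -/

/-- The curve `z` has a continuous determination of its argument that varies by `2π m` over
`[0, 2π]`. -/
def HasWinding (z : ℝ → ℂ) (m : ℤ) : Prop :=
  ∃ θ : ℝ → ℝ, Continuous θ ∧
    (∀ φ, z φ = (‖z φ‖ : ℂ) * Complex.exp ((θ φ : ℂ) * Complex.I)) ∧
    θ (2 * Real.pi) - θ 0 = m * (2 * Real.pi)

theorem HasWinding.mul {z w : ℝ → ℂ} {m l : ℤ} (hz : HasWinding z m) (hw : HasWinding w l) :
    HasWinding (fun φ => z φ * w φ) (m + l) := by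
  obtain ⟨θ, hc, he, hm⟩ := hz
  obtain ⟨ψ, hc', he', hm'⟩ := hw
  refine ⟨fun φ => θ φ + ψ φ, hc.add hc', fun φ => ?_, ?_⟩
  · push_cast
    rw [norm_mul, add_mul, Complex.exp_add]
    push_cast
    conv_lhs => rw [he φ, he' φ]
    ring
  · push_cast
    linarith

/-- Two loops at each time less than a right angle apart have the same winding number. -/
theorem HasWinding.of_re_pos {z w : ℝ → ℂ} {m : ℤ} (hw : HasWinding w m) (hzc : Continuous z)
    (hwc : Continuous w) (hz0 : z (2 * Real.pi) = z 0) (hw0 : w (2 * Real.pi) = w 0)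
    (h : ∀ φ, 0 < (z φ * (starRingEnd ℂ) (w φ)).re) : HasWinding z m := by
  obtain ⟨θ, hc, he, hm⟩ := hw
  -- The correction `arg (z * conj w)` is continuous because its argument stays in the right
  -- half-plane, and it takes equal values at both ends because the loops close.
  refine ⟨fun φ => θ φ + Complex.arg (z φ * (starRingEnd ℂ) (w φ)), ?_, fun φ => ?_, ?_⟩
  · refine hc.add (continuous_iff_continuousAt.2 fun φ => ?_)
    have h1 : Continuous fun φ => z φ * (starRingEnd ℂ) (w φ) :=
      hzc.mul (Complex.continuous_conj.comp hwc)
    exact (Complex.continuousAt_arg (Or.inl (h φ))).comp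
      (f := fun φ => z φ * (starRingEnd ℂ) (w φ)) h1.continuousAt
  · have hne : w φ ≠ 0 := by
      intro h0
      have := h φ
      simp [h0] at this
    have hn : (‖w φ‖ : ℂ) ≠ 0 := by simpa using hne
    have h1 := Complex.norm_mul_exp_arg_mul_I (z φ * (starRingEnd ℂ) (w φ))
    rw [norm_mul, RCLike.norm_conj] at h1
    push_cast at h1 ⊢
    rw [add_mul, Complex.exp_add]
    have h2 : w φ * (starRingEnd ℂ) (w φ) = (‖w φ‖ : ℂ) ^ 2 := Complex.mul_conj' _
    have h3 := he φ
    set e := Complex.exp (θ φ * Complex.I)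
    set g := Complex.exp (Complex.arg (z φ * (starRingEnd ℂ) (w φ)) * Complex.I)
    apply mul_left_cancel₀ (pow_ne_zero 2 hn)
    calc (‖w φ‖ : ℂ) ^ 2 * z φ = w φ * (z φ * (starRingEnd ℂ) (w φ)) := by rw [← h2]; ring
      _ = (‖w φ‖ * e) * (‖z φ‖ * ‖w φ‖ * g) := by rw [h1, ← h3]
      _ = _ := by ring
  · simp only [hz0, hw0]
    linarith

/-! ### The phase curve F + iF' -/

/-- The loop `F + i F'`, where `F` is the restriction of `f` to the unit circle. -/
noncomputable def phaseCurve (f : RealPoly2) (φ : ℝ) : ℂ :=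
  ⟨eval ![Real.cos φ, Real.sin φ] f,
    -Real.sin φ * eval ![Real.cos φ, Real.sin φ] (pderiv 0 f)
      + Real.cos φ * eval ![Real.cos φ, Real.sin φ] (pderiv 1 f)⟩

theorem continuous_eval_circle (f : RealPoly2) :
    Continuous fun φ : ℝ => eval ![Real.cos φ, Real.sin φ] f := by
  refine (MvPolynomial.continuous_eval f).comp (continuous_pi fun i => ?_)
  fin_cases i
  · exact Real.continuous_cos
  · exact Real.continuous_sin

theorem Complex.continuous_mk {a b : ℝ → ℝ} (ha : Continuous a) (hb : Continuous b) :
    Continuous fun φ => (⟨a φ, b φ⟩ : ℂ) := by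
  have : (fun φ => (⟨a φ, b φ⟩ : ℂ)) = fun φ => (a φ : ℂ) + b φ * Complex.I := by
    ext φ
    exact Complex.mk_eq_add_mul_I _ _
  rw [this]
  fun_prop

theorem continuous_phaseCurve (f : RealPoly2) : Continuous (phaseCurve f) :=
  Complex.continuous_mk (continuous_eval_circle f)
    ((Real.continuous_sin.neg.mul (continuous_eval_circle _)).add
      (Real.continuous_cos.mul (continuous_eval_circle _)))

theorem phaseCurve_two_pi (f : RealPoly2) : phaseCurve f (2 * Real.pi) = phaseCurve f 0 := by
  simp [phaseCurve]

theorem circle_ne_zero (φ : ℝ) : (![Real.cos φ, Real.sin φ] : Fin 2 → ℝ) ≠ 0 := by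
  intro h
  have h0 : Real.cos φ = 0 := congrFun h 0
  have h1 : Real.sin φ = 0 := congrFun h 1
  have := Real.sin_sq_add_cos_sq φ
  simp [h0, h1] at this

theorem hasWinding_phaseCurve_of_pos {f : RealPoly2}
    (h : ∀ v : Fin 2 → ℝ, v ≠ 0 → 0 < eval v f) : HasWinding (phaseCurve f) 0 := by
  have h1 : HasWinding (fun _ => 1) 0 := ⟨fun _ => 0, continuous_const, by simp, by simp⟩
  refine h1.of_re_pos (continuous_phaseCurve f) continuous_const (phaseCurve_two_pi f) rfl
    fun φ => ?_
  simpa [phaseCurve] using h _ (circle_ne_zero φ)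

theorem phaseCurve_lineForm (r φ : ℝ) :
    phaseCurve (lineForm r) φ = (1 - r * Complex.I) * Complex.exp (((-φ : ℝ) : ℂ) * Complex.I) := by
  rw [Complex.exp_mul_I, ← Complex.ofReal_cos, ← Complex.ofReal_sin]
  apply Complex.ext
  · simp [phaseCurve, eval_lineForm, -Complex.ofReal_cos, -Complex.ofReal_sin]
  · simp [phaseCurve, pderiv_zero_lineForm, pderiv_one_lineForm, -Complex.ofReal_cos,
      -Complex.ofReal_sin]
    ring

theorem hasWinding_phaseCurve_lineForm (r : ℝ) : HasWinding (phaseCurve (lineForm r)) (-1) := by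
  refine ⟨fun φ => Complex.arg (1 - r * Complex.I) + -φ, by fun_prop, fun φ => ?_, ?_⟩
  · rw [phaseCurve_lineForm, norm_mul, Complex.norm_exp_ofReal_mul_I, mul_one]
    push_cast
    rw [add_mul, Complex.exp_add, ← mul_assoc, Complex.norm_mul_exp_arg_mul_I]
  · simp

/-- Multiplying by a linear form that is not a factor decreases the winding number by one. -/
theorem HasWinding.mul_lineForm {f : RealPoly2} {m : ℤ} (hf : HasWinding (phaseCurve f) m) (r : ℝ)
    (hr : ∀ v : Fin 2 → ℝ, v ≠ 0 → v 0 = r * v 1 → eval v f ≠ 0)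
    (hs : ∀ φ, phaseCurve f φ ≠ 0) :
    HasWinding (phaseCurve (f * lineForm r)) (m - 1) ∧
      ∀ φ, phaseCurve (f * lineForm r) φ ≠ 0 := by
  have hpos : ∀ φ, 0 < (phaseCurve (f * lineForm r) φ *
      (starRingEnd ℂ) (phaseCurve f φ * phaseCurve (lineForm r) φ)).re := by
    intro φ
    have h1 := hr _ (circle_ne_zero φ)
    have h2 := hs φ
    have h3 := Real.sin_sq_add_cos_sq φ
    simp only [phaseCurve, pderiv_mul, pderiv_zero_lineForm, pderiv_one_lineForm, map_add, map_mul,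
      eval_lineForm, map_neg, eval_C, mul_one, Matrix.cons_val_zero, Matrix.cons_val_one,
      map_one, ne_eq, Complex.ext_iff, Complex.zero_re, Complex.zero_im, not_and,
      Complex.mul_re, Complex.mul_im, Complex.conj_re, Complex.conj_im] at h1 h2 ⊢
    generalize Real.sin φ = s at *
    generalize Real.cos φ = c at *
    generalize eval ![c, s] f = a at *
    generalize eval ![c, s] (pderiv 0 f) = p at *
    generalize eval ![c, s] (pderiv 1 f) = q at *
    set T := -s * p + c * q with hT
    set l := c - r * s with hl
    set k := -s - r * c with hk
    -- With F = a, F' = T for `f` and l, k for the linear form, this is the real part of (al + i(Tl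
    -- + ak)) times the conjugate of (a + iT)(l + ik). It could vanish only if a = T l = 0.
    have key : 0 < (a * k) ^ 2 + (a * k) * (T * l) + (T * l) ^ 2 + (a * l) ^ 2 := by
      have hlk : l ^ 2 + k ^ 2 = 1 + r ^ 2 := by
        rw [hl, hk]; linear_combination (1 + r ^ 2) * h3
      by_cases ha : a = 0
      · have hT0 : T ≠ 0 := h2 ha
        have hl0 : l ≠ 0 := fun h0 => h1 (by linarith) ha
        have := mul_ne_zero hT0 hl0
        rw [ha]
        simp only [zero_mul]
        positivity
      · have : 0 < a ^ 2 * (l ^ 2 + k ^ 2) := by rw [hlk]; positivity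
        nlinarith [sq_nonneg (a * k + 2 * (T * l)), sq_nonneg (a * l), sq_nonneg (a * k)]
    convert key using 1
    rw [hT, hk]
    ring
  refine ⟨?_, fun φ h0 => ?_⟩
  · exact (hf.mul (hasWinding_phaseCurve_lineForm r)).of_re_pos (continuous_phaseCurve _)
      ((continuous_phaseCurve _).mul (continuous_phaseCurve _)) (phaseCurve_two_pi _)
      (by simp only [phaseCurve_two_pi]) hpos
  · have := hpos φ
    simp [h0] at this

/-! ### From the phase curve to the index -/

theorem IsHyperbolicForm.isHyperbolicCurve {D : ℕ} {f : RealPoly2} (hf : IsHyperbolicForm D f) :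
    IsHyperbolicCurve (secondFormCurve f) := by
  refine ⟨Continuous.continuousOn ?_, fun φ _ => ?_⟩
  · exact (continuous_eval_circle _).prodMk
      ((continuous_eval_circle _).prodMk (continuous_eval_circle _))
  · have := hf.2 _ (circle_ne_zero φ)
    rwa [eval_hessPoly] at this

/-- In the frame rotating with `φ`, the curve of second fundamental forms is homotopic to the
phase curve, so that the index exceeds the winding number of the latter by two. -/
theorem IsHyperbolicForm.hasIndex {D : ℕ} {f : RealPoly2} (hf : IsHyperbolicForm D f)
    (hD : 2 ≤ D) {m : ℤ} (hm : HasWinding (phaseCurve f) m) :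
    HasIndex (secondFormCurve f) (2 + m) := by
  refine ⟨hf.isHyperbolicCurve, ?_⟩
  have hrot : HasWinding (fun φ : ℝ => Complex.exp (((2 * φ : ℝ) : ℂ) * Complex.I)) 2 := by
    refine ⟨fun φ => 2 * φ, by fun_prop, fun φ => ?_, by push_cast; ring⟩
    rw [Complex.norm_exp_ofReal_mul_I, Complex.ofReal_one, one_mul]
  have hcont : Continuous fun φ => formToComplex (secondFormCurve f φ) :=
    Complex.continuous_mk ((continuous_eval_circle _).sub (continuous_eval_circle _))
      (continuous_const.mul (continuous_eval_circle _))
  have hwind : HasWinding (fun φ => formToComplex (secondFormCurve f φ)) (2 + m) := by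
    refine (hrot.mul hm).of_re_pos hcont
      ((by fun_prop : Continuous fun φ : ℝ => Complex.exp (((2 * φ : ℝ) : ℂ) * Complex.I)).mul
        (continuous_phaseCurve f)) (by simp [secondFormCurve]) ?_ fun φ => ?_
    · rw [phaseCurve_two_pi, Complex.exp_mul_I, Complex.exp_mul_I, ← Complex.ofReal_cos,
        ← Complex.ofReal_sin, ← Complex.ofReal_cos, ← Complex.ofReal_sin]
      norm_num [Real.cos_two_mul, Real.sin_two_mul]
    · rw [Complex.exp_mul_I, ← Complex.ofReal_cos, ← Complex.ofReal_sin, Real.cos_two_mul',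
        Real.sin_two_mul]
      have e := hf.1.euler_eval ![Real.cos φ, Real.sin φ]
      have e0 := hf.1.euler_eval_pderiv_zero (by omega) ![Real.cos φ, Real.sin φ]
      have e1 := hf.1.euler_eval_pderiv_one (by omega) ![Real.cos φ, Real.sin φ]
      have hneg := hf.2 _ (circle_ne_zero φ)
      have hD' : (2 : ℝ) ≤ D := by exact_mod_cast hD
      have h3 := Real.sin_sq_add_cos_sq φ
      rw [eval_hessPoly] at hneg
      simp only [phaseCurve, formToComplex, secondFormCurve, Complex.mul_re, Complex.mul_im,
        Complex.conj_re, Complex.conj_im, Complex.add_re, Complex.add_im, Complex.ofReal_re,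
        Complex.ofReal_im, Complex.I_re, Complex.I_im, Matrix.cons_val_zero,
        Matrix.cons_val_one] at e e0 e1 ⊢
      generalize (D : ℝ) = d at *
      generalize Real.sin φ = s at *
      generalize Real.cos φ = c at *
      generalize eval ![c, s] f = a at *
      generalize eval ![c, s] (pderiv 0 f) = p at *
      generalize eval ![c, s] (pderiv 1 f) = q at *
      generalize eval ![c, s] (pderiv 0 (pderiv 0 f)) = A at *
      generalize eval ![c, s] (pderiv 0 (pderiv 1 f)) = B at *
      generalize eval ![c, s] (pderiv 1 (pderiv 1 f)) = E at *
      -- T is F'. M, N, K are the radial, tangential and mixed second derivatives, so that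
      -- e^{-2iφ}(A - E + 2Bi) = M - N + 2Ki.
      set T := -s * p + c * q with hT
      set N := s ^ 2 * A - 2 * s * c * B + c ^ 2 * E with hN
      set M := c ^ 2 * A + 2 * s * c * B + s ^ 2 * E with hM
      set K := s * c * (E - A) + (c ^ 2 - s ^ 2) * B with hK
      have hMa : M = (d - 1) * d * a := by
        rw [hM]; linear_combination (d - 1) * e + c * e0 + s * e1
      have hKT : K = (d - 1) * T := by
        rw [hK, hT]; linear_combination -s * e0 + c * e1
      have hdet : A * E - B ^ 2 = M * N - K ^ 2 := by
        rw [hM, hN, hK]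
        linear_combination -(A * E - B ^ 2) * (s ^ 2 + c ^ 2 + 1) * h3
      rw [hdet, hMa, hKT] at hneg
      have h4 : d * a * N - (d - 1) * T ^ 2 < 0 := by
        by_contra! h
        nlinarith [mul_nonneg (by linarith : (0:ℝ) ≤ d - 1) h]
      -- By `h4`, d times this exceeds d²(d-1)a² + (2d-1)(d-1)T².
      have h5 : 0 < (M - N) * a + 2 * K * T := by
        rw [hMa, hKT]
        have : 0 < d * (((d - 1) * d * a - N) * a + 2 * ((d - 1) * T) * T) := by
          nlinarith [mul_nonneg (by nlinarith : (0:ℝ) ≤ d ^ 2 * (d - 1)) (sq_nonneg a),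
            mul_nonneg (by nlinarith : (0:ℝ) ≤ (2 * d - 1) * (d - 1)) (sq_nonneg T)]
        exact pos_of_mul_pos_right this (by linarith)
      convert h5 using 1
      rw [hM, hN, hK]
      ring
  obtain ⟨θ, hc, he, hθ⟩ := hwind
  refine ⟨θ, hc.continuousOn, fun φ _ => he φ, ?_⟩
  rw [hθ]
  field_simp

/-! ### The power-sum inequality -/

theorem Real.nat_sq_mul_sinh_sq_le (k : ℕ) (s : ℝ) :
    (k : ℝ) ^ 2 * Real.sinh s ^ 2 ≤ Real.sinh (k * s) ^ 2 := by
  have h : (k : ℝ) * |Real.sinh s| ≤ |Real.sinh (k * s)| := by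
    induction k with
    | zero => simp
    | succ k ih =>
      wlog hs : 0 ≤ s generalizing s
      · have := this (-s) (by simpa using ih) (by linarith)
        simpa using this
      have h1 := Real.sinh_nonneg_iff.2 hs
      have h2 : 0 ≤ Real.sinh (k * s) := Real.sinh_nonneg_iff.2 (by positivity)
      have h3 : 0 ≤ Real.sinh ((k + 1 : ℕ) * s) := Real.sinh_nonneg_iff.2 (by positivity)
      rw [abs_of_nonneg h1, abs_of_nonneg h2] at ih
      rw [abs_of_nonneg h1, abs_of_nonneg h3]
      push_cast
      rw [add_mul, one_mul, add_mul, one_mul, Real.sinh_add]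
      nlinarith [Real.one_le_cosh s, Real.one_le_cosh (k * s)]
  have h2 := pow_le_pow_left₀ (by positivity) h 2
  rwa [mul_pow, sq_abs, sq_abs] at h2

/-- Since cosh u - 1 = 2 sinh²(u/2), this is the preceding bound at t/2. It makes cosh(kt) at least
a polynomial in cosh t. -/
theorem Real.one_add_nat_sq_mul_cosh_sub_one_le (k : ℕ) (t : ℝ) :
    1 + (k : ℝ) ^ 2 * (Real.cosh t - 1) ≤ Real.cosh (k * t) := by
  have h := Real.nat_sq_mul_sinh_sq_le k (t / 2)
  have h1 := Real.cosh_two_mul (t / 2)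
  have h2 := Real.cosh_two_mul (k * (t / 2))
  have h3 := Real.cosh_sq (t / 2)
  have h4 := Real.cosh_sq (k * (t / 2))
  rw [show 2 * (t / 2) = t by ring] at h1
  rw [show 2 * ((k : ℝ) * (t / 2)) = k * t by ring] at h2
  rw [h1, h2, h3, h4]
  linarith

theorem exists_forall_pow_add_pow_eq_cosh {x y : ℝ} (hx : 0 < x) (hy : 0 < y) :
    ∃ t : ℝ, ∀ k : ℕ, x ^ (2 * k) + y ^ (2 * k) = 2 * (x ^ k * y ^ k) * Real.cosh (k * t) := by
  refine ⟨Real.log x - Real.log y, fun k => ?_⟩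
  have h1 : Real.exp (k * (Real.log x - Real.log y)) = x ^ k / y ^ k := by
    rw [mul_sub, Real.exp_sub, Real.exp_nat_mul, Real.exp_nat_mul, Real.exp_log hx,
      Real.exp_log hy]
  rw [Real.cosh_eq, Real.exp_neg, h1]
  field_simp
  ring

/-- The inequality between power sums that expresses the hyperbolicity of
`(x² - y²) (x^{2n} + y^{2n})` for `n = m + 2` off the coordinate axes. -/
theorem gForm_inequality (m : ℕ) {x y : ℝ} (hx : x ≠ 0) (hy : y ≠ 0) :
    ((m : ℝ) + 2) ^ 2 * (2 * (m + 2) + 1) * (x ^ (2 * (m + 2)) * y ^ (2 * (m + 2)))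
        * (x ^ 2 - y ^ 2) ^ 2
      < (m + 3) * (x ^ 2 * y ^ 2) * (x ^ (2 * (m + 2)) + y ^ (2 * (m + 2))) ^ 2
        + (m + 2) * (x ^ (2 * (m + 2)) + y ^ (2 * (m + 2)))
          * (x ^ 4 * y ^ (2 * (m + 2)) + y ^ 4 * x ^ (2 * (m + 2))) := by
  wlog hpos : 0 < x ∧ 0 < y generalizing x y
  · have h := this (abs_ne_zero.2 hx) (abs_ne_zero.2 hy) ⟨abs_pos.2 hx, abs_pos.2 hy⟩
    have he : ∀ z : ℝ, |z| ^ (2 * (m + 2)) = z ^ (2 * (m + 2)) := fun z =>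
      (even_two_mul _).pow_abs z
    have h4 : ∀ z : ℝ, |z| ^ 4 = z ^ 4 := fun z => (by decide : Even 4).pow_abs z
    simpa only [he, h4, sq_abs] using h
  obtain ⟨hx, hy⟩ := hpos
  obtain ⟨t, ht⟩ := exists_forall_pow_add_pow_eq_cosh hx hy
  have c1 := Real.one_add_nat_sq_mul_cosh_sub_one_le (m + 2) t
  have c2 := Real.one_add_nat_sq_mul_cosh_sub_one_le m t
  have c3 := Real.one_le_cosh t
  have e1 := ht 1
  have e2 := ht (m + 2)
  have e3 := ht m
  rw [Nat.cast_one, one_mul] at e1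
  have hm : (0 : ℝ) ≤ m := m.cast_nonneg
  push_cast at c1 e1 e2
  have e4 : x ^ 4 * y ^ (2 * (m + 2)) + y ^ 4 * x ^ (2 * (m + 2))
      = (x * y) ^ 4 * (x ^ (2 * m) + y ^ (2 * m)) := by ring
  have e5 : (x ^ 2 - y ^ 2) ^ 2 = 4 * (x * y) ^ 2 * (Real.cosh t ^ 2 - 1) := by
    linear_combination (x ^ (2 * 1) + y ^ (2 * 1) + 2 * (x ^ 1 * y ^ 1) * Real.cosh t) * e1
  have e6 : x ^ (2 * (m + 2)) * y ^ (2 * (m + 2)) = (x * y) ^ 4 * (x ^ m * y ^ m) ^ 2 := by ring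
  have e7 : x ^ (m + 2) * y ^ (m + 2) = (x * y) ^ 2 * (x ^ m * y ^ m) := by ring
  rw [e4, e5, e6, e2, e3, e7]
  have hr : 0 < x * y := by positivity
  have hs : 0 < x ^ m * y ^ m := by positivity
  rw [← mul_pow x y 2]
  generalize x ^ m * y ^ m = s at *
  generalize x * y = r at *
  generalize Real.cosh ((m + 2) * t) = P at *
  generalize Real.cosh (m * t) = Q at *
  generalize Real.cosh t = c at *
  clear e1 e2 e3 e4 e5 e6 e7 ht
  generalize (m : ℝ) = u at *
  -- After the substitution both sides carry the factor 4 r⁶ s², and P, Q have lower bounds affine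
  -- in v = cosh t - 1.
  obtain ⟨v, rfl⟩ : ∃ v, c = 1 + v := ⟨c - 1, by ring⟩
  have hv : 0 ≤ v := by linarith
  simp only [add_sub_cancel_left] at c1 c2
  have k1 : (1 + (u + 2) ^ 2 * v) ^ 2 ≤ P ^ 2 := pow_le_pow_left₀ (by positivity) c1 2
  have k2 : (1 + (u + 2) ^ 2 * v) * (1 + u ^ 2 * v) ≤ P * Q :=
    mul_le_mul c1 c2 (by positivity) (le_trans (by positivity) c1)
  have k3 : 0 < (u + 3) * P ^ 2 + (u + 2) * (P * Q)
      - (u + 2) ^ 2 * (2 * (u + 2) + 1) * ((1 + v) ^ 2 - 1) := by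
    -- The quadratic in v obtained from those bounds has a negative linear coefficient -4(u+2)(u+1);
    -- completing the square absorbs it.
    have k4 : 0 < 2 * (u + 2) + (1 - 2 * (u + 2) * (u + 1) * v) ^ 2
        + (u + 2) ^ 2 * (u + 1) * (2 * u ^ 2 + 3 * u + 3) * v ^ 2 := by positivity
    have k5 := mul_le_mul_of_nonneg_left k1 (by linarith : 0 ≤ u + 3)
    have k6 := mul_le_mul_of_nonneg_left k2 (by linarith : 0 ≤ u + 2)
    refine lt_of_lt_of_le k4 (le_trans (le_of_eq ?_) (sub_le_sub_right (add_le_add k5 k6) _))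
    ring
  have k7 : 0 < 4 * r ^ 6 * s ^ 2 := by positivity
  nlinarith [mul_pos k7 k3]

/-! ### Hyperbolicity of (x² - y²)(x^{2n} + y^{2n}) -/

theorem ne_zero_coordinate {v : Fin 2 → ℝ} (hv : v ≠ 0) : v 0 ≠ 0 ∨ v 1 ≠ 0 := by
  by_contra! h
  exact hv (by ext i; fin_cases i <;> simp [h.1, h.2])

/-- The form `x^{2n} + y^{2n}`. -/
noncomputable def powerSumForm (n : ℕ) : RealPoly2 := X 0 ^ (2 * n) + X 1 ^ (2 * n)

theorem eval_powerSumForm_pos (n : ℕ) (v : Fin 2 → ℝ) (hv : v ≠ 0) :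
    0 < eval v (powerSumForm n) := by
  simp only [powerSumForm, map_add, map_pow, eval_X]
  have h0 := (even_two_mul n).pow_nonneg (v 0)
  have h1 := (even_two_mul n).pow_nonneg (v 1)
  rcases ne_zero_coordinate hv with h | h
  · have := (even_two_mul n).pow_pos h
    linarith
  · have := (even_two_mul n).pow_pos h
    linarith

theorem powerSumForm_isHomogeneous (n : ℕ) : (powerSumForm n).IsHomogeneous (2 * n) :=
  (isHomogeneous_X_pow 0 _).add (isHomogeneous_X_pow 1 _)

theorem gForm_eq (n : ℕ) : gForm n = powerSumForm n * lineForm 1 * lineForm (-1) := by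
  simp only [gForm, powerSumForm, lineForm, map_neg, map_one]
  ring

theorem gForm_isHomogeneous (n : ℕ) : (gForm n).IsHomogeneous (2 * n + 2) := by
  rw [gForm_eq]
  exact ((powerSumForm_isHomogeneous n).mul (lineForm_isHomogeneous 1)).mul
    (lineForm_isHomogeneous (-1))

theorem pderiv_ofNat (i : Fin 2) (n : ℕ) [n.AtLeastTwo] :
    pderiv i (OfNat.ofNat n : RealPoly2) = 0 :=
  (pderiv i).map_natCast n

theorem gForm_isHyperbolicForm (n : ℕ) (hn : 2 ≤ n) : IsHyperbolicForm (2 * n + 2) (gForm n) := by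
  refine ⟨gForm_isHomogeneous n, fun v hv => ?_⟩
  obtain ⟨m, rfl⟩ := Nat.exists_eq_add_of_le' hn
  have hsub : 2 * (m + 2) - 1 = 2 * m + 3 := by omega
  have hsub' : 2 * m + 3 - 1 = 2 * m + 2 := by omega
  have hv' := ne_zero_coordinate hv
  have hineq := @gForm_inequality m (v 0) (v 1)
  have hxx : eval v (pderiv 0 (pderiv 0 (gForm (m + 2)))) =
      2 * (v 0 ^ (2 * m + 4) + v 1 ^ (2 * m + 4)) + 8 * (m + 2) * v 0 ^ (2 * m + 4)
        + (v 0 ^ 2 - v 1 ^ 2) * (2 * (m + 2) * (2 * m + 3)) * v 0 ^ (2 * m + 2) := by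
    simp [gForm, pderiv_X, hsub, hsub']
    repeat rw [pderiv_ofNat]
    simp only [map_zero]
    ring
  have hxy : eval v (pderiv 0 (pderiv 1 (gForm (m + 2)))) =
      4 * (m + 2) * (v 0 * v 1) * (v 1 ^ (2 * m + 2) - v 0 ^ (2 * m + 2)) := by
    simp [gForm, pderiv_X, hsub, hsub']
    repeat rw [pderiv_ofNat]
    simp only [map_zero]
    ring
  have hyy : eval v (pderiv 1 (pderiv 1 (gForm (m + 2)))) =
      -2 * (v 0 ^ (2 * m + 4) + v 1 ^ (2 * m + 4)) - 8 * (m + 2) * v 1 ^ (2 * m + 4)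
        + (v 0 ^ 2 - v 1 ^ 2) * (2 * (m + 2) * (2 * m + 3)) * v 1 ^ (2 * m + 2) := by
    simp [gForm, pderiv_X, hsub, hsub']
    repeat rw [pderiv_ofNat]
    simp only [map_zero]
    ring
  rw [eval_hessPoly, hxx, hxy, hyy]
  have hm : (0 : ℝ) ≤ m := m.cast_nonneg
  generalize v 0 = x at *
  generalize v 1 = y at *
  by_cases hx : x = 0
  · subst hx
    have hy : y ≠ 0 := by simpa using hv'
    have h1 : 0 < y ^ (2 * m + 4) := Even.pow_pos ⟨m + 2, by ring⟩ hy
    have h2 : y ^ (2 * m + 4) = y ^ 2 * y ^ (2 * m + 2) := by ring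
    have h3 : (0 : ℝ) ^ (2 * m + 4) = 0 := by simp
    -- Here n ≥ 2 matters: for n = 1 this exponent 2n - 2 is 0 and f_xx vanishes on x = 0.
    have h4 : (0 : ℝ) ^ (2 * m + 2) = 0 := by simp
    rw [h3, h4]
    have : 0 < 2 * y ^ (2 * m + 4) * (y ^ (2 * m + 4)
      * (2 + 8 * (m + 2) + 2 * (m + 2) * (2 * m + 3))) := by positivity
    refine lt_of_eq_of_lt ?_ (neg_neg_of_pos this)
    rw [h2]
    ring
  by_cases hy : y = 0
  · subst hy
    have h1 : 0 < x ^ (2 * m + 4) := Even.pow_pos ⟨m + 2, by ring⟩ hx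
    have h2 : x ^ (2 * m + 4) = x ^ 2 * x ^ (2 * m + 2) := by ring
    have h3 : (0 : ℝ) ^ (2 * m + 4) = 0 := by simp
    have h4 : (0 : ℝ) ^ (2 * m + 2) = 0 := by simp
    rw [h3, h4]
    have : 0 < 2 * x ^ (2 * m + 4) * (x ^ (2 * m + 4)
      * (2 + 8 * (m + 2) + 2 * (m + 2) * (2 * m + 3))) := by positivity
    refine lt_of_eq_of_lt ?_ (neg_neg_of_pos this)
    rw [h2]
    ring
  have h := hineq hx hy
  have hpos : 0 < x ^ 2 * y ^ 2 := by positivity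
  have hfac : (0 : ℝ) < 4 * (2 * (m + 2) + 1) := by positivity
  have hlt := mul_pos hfac (sub_pos.2 h)
  -- The inequality is, up to the factor 4(2n+1), the negated Hessian times x²y²; hence the separate
  -- treatment of the axes.
  refine (pos_iff_pos_of_mul_pos (a := x ^ 2 * y ^ 2) (b := -_) ?_).1 hpos |> neg_pos.1
  refine lt_of_lt_of_eq hlt ?_
  have p1 : x ^ (2 * (m + 2)) = x ^ 2 * x ^ (2 * m + 2) := by ring
  have p2 : y ^ (2 * (m + 2)) = y ^ 2 * y ^ (2 * m + 2) := by ring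
  have p3 : x ^ (2 * m + 4) = x ^ 2 * x ^ (2 * m + 2) := by ring
  have p4 : y ^ (2 * m + 4) = y ^ 2 * y ^ (2 * m + 2) := by ring
  rw [p1, p2, p3, p4]
  generalize x ^ (2 * m + 2) = a
  generalize y ^ (2 * m + 2) = b
  ring

/-! ### Adding the lines x = 0 and x = ±(k+1)y -/

theorem fOddForm_one (n : ℕ) : fOddForm n 1 = gForm n * lineForm 0 := by
  simp [fOddForm, gForm, linesProd, lineForm]
  ring

theorem fEvenForm_eq (n k : ℕ) : fEvenForm n k = fOddForm n k * lineForm (k + 1) := by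
  simp only [fEvenForm, fOddForm, lineForm]
  ring

theorem fOddForm_succ (n k : ℕ) :
    fOddForm n (k + 1) = fEvenForm n k * lineForm (-(k + 1)) := by
  rw [fEvenForm, fOddForm, linesProd, Finset.prod_Icc_succ_top (by omega), ← linesProd]
  simp only [lineForm, map_neg, map_pow, map_add, Nat.cast_add, Nat.cast_one]
  ring

theorem ne_zero_of_eq_mul {v : Fin 2 → ℝ} (hv : v ≠ 0) {r : ℝ} (h : v 0 = r * v 1) : v 1 ≠ 0 := by
  intro h1
  rcases ne_zero_coordinate hv with h0 | h0
  · exact h0 (by rw [h, h1, mul_zero])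
  · exact h0 h1

theorem eval_linesProd_ne_zero (k : ℕ) {v : Fin 2 → ℝ} (hv : v ≠ 0) {r : ℝ}
    (hr : r ^ 2 = ((k : ℝ) + 1) ^ 2) (h : v 0 = r * v 1) : eval v (linesProd k) ≠ 0 := by
  have h1 := ne_zero_of_eq_mul hv h
  rw [linesProd, map_prod, Finset.prod_ne_zero_iff]
  intro i hi
  have hik : (i : ℝ) < k + 1 := by exact_mod_cast Nat.lt_succ_of_le (Finset.mem_Icc.1 hi).2
  simp only [map_sub, map_pow, map_mul, eval_X, eval_C, h, mul_pow, hr, ← sub_mul]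
  have h2 : (i : ℝ) ^ 2 < ((k : ℝ) + 1) ^ 2 := pow_lt_pow_left₀ hik i.cast_nonneg two_ne_zero
  exact mul_ne_zero (sub_pos.2 h2).ne' (pow_ne_zero 2 h1)

theorem eval_fOddForm_ne_zero (n k : ℕ) {v : Fin 2 → ℝ} (hv : v ≠ 0) {r : ℝ}
    (hr : r ^ 2 = ((k : ℝ) + 1) ^ 2) (h : v 0 = r * v 1) : eval v (fOddForm n k) ≠ 0 := by
  have h1 := ne_zero_of_eq_mul hv h
  have hr0 : r ≠ 0 := by
    rintro rfl
    have : (0 : ℝ) < ((k : ℝ) + 1) ^ 2 := by positivity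
    simp [← hr] at this
  rw [fOddForm, map_mul, map_mul, eval_X, h]
  exact mul_ne_zero (mul_ne_zero (mul_ne_zero hr0 h1) (eval_powerSumForm_pos n v hv).ne')
    (eval_linesProd_ne_zero k hv hr h)

theorem eval_fEvenForm_ne_zero (n k : ℕ) {v : Fin 2 → ℝ} (hv : v ≠ 0)
    (h : v 0 = -((k : ℝ) + 1) * v 1) : eval v (fEvenForm n k) ≠ 0 := by
  have h1 := ne_zero_of_eq_mul hv h
  rw [fEvenForm_eq, map_mul, eval_lineForm]
  refine mul_ne_zero (eval_fOddForm_ne_zero n k hv (neg_sq _) h) ?_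
  rw [h, ← sub_mul]
  have : (0 : ℝ) < k + 1 := by positivity
  exact mul_ne_zero (by linarith) h1

theorem eval_gForm_ne_zero (n : ℕ) {v : Fin 2 → ℝ} (hv : v ≠ 0) (h : v 0 = 0 * v 1) :
    eval v (gForm n) ≠ 0 := by
  have h1 := ne_zero_of_eq_mul hv h
  rw [gForm_eq, map_mul, map_mul, eval_lineForm, eval_lineForm, h]
  exact mul_ne_zero (mul_ne_zero (eval_powerSumForm_pos n v hv).ne' (by simpa using h1))
    (by simpa using h1)

/-! ### Winding numbers of the three families -/

theorem gForm_hasWinding (n : ℕ) :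
    HasWinding (phaseCurve (gForm n)) (-2) ∧ ∀ φ, phaseCurve (gForm n) φ ≠ 0 := by
  have hpos := eval_powerSumForm_pos n
  have h0 := hasWinding_phaseCurve_of_pos hpos
  have h1 := h0.mul_lineForm 1 (fun v hv _ => (hpos v hv).ne') fun φ h => by
    have := hpos _ (circle_ne_zero φ)
    have h2 : eval ![Real.cos φ, Real.sin φ] (powerSumForm n) = 0 := congrArg Complex.re h
    exact this.ne' h2
  have h2 := h1.1.mul_lineForm (-1) (fun v hv h => by
    have h3 := ne_zero_of_eq_mul hv h
    rw [map_mul, eval_lineForm, h]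
    refine mul_ne_zero (hpos v hv).ne' ?_
    rw [← sub_mul]
    exact mul_ne_zero (by norm_num) h3) h1.2
  rw [gForm_eq]
  exact h2

theorem fOddForm_hasWinding (n : ℕ) {k : ℕ} (hk : 1 ≤ k) :
    HasWinding (phaseCurve (fOddForm n k)) (-(2 * k) - 1) ∧
      ∀ φ, phaseCurve (fOddForm n k) φ ≠ 0 := by
  induction k, hk using Nat.le_induction with
  | base =>
    rw [fOddForm_one]
    exact (gForm_hasWinding n).1.mul_lineForm 0 (fun v hv => eval_gForm_ne_zero n hv)
      (gForm_hasWinding n).2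
  | succ k _ ih =>
    have h1 := ih.1.mul_lineForm (k + 1) (fun v hv => eval_fOddForm_ne_zero n k hv rfl) ih.2
    rw [← fEvenForm_eq] at h1
    have h2 := h1.1.mul_lineForm (-(k + 1)) (fun v hv => eval_fEvenForm_ne_zero n k hv) h1.2
    rw [← fOddForm_succ] at h2
    refine ⟨?_, h2.2⟩
    convert h2.1 using 1
    push_cast
    ring

theorem fEvenForm_hasWinding (n : ℕ) {k : ℕ} (hk : 1 ≤ k) :
    HasWinding (phaseCurve (fEvenForm n k)) (-(2 * k) - 1 - 1) := by
  rw [fEvenForm_eq]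
  exact ((fOddForm_hasWinding n hk).1.mul_lineForm (k + 1)
    (fun v hv => eval_fOddForm_ne_zero n k hv rfl) (fOddForm_hasWinding n hk).2).1

/-! ### Hyperbolicity of the two families of products -/

theorem IsHyperbolicForm.fEvenForm_of_fOddForm {n k : ℕ} (hn : 1 ≤ n)
    (h : IsHyperbolicForm (2 * n + 2 * k + 1) (fOddForm n k)) :
    IsHyperbolicForm (2 * n + 2 * k + 2) (fEvenForm n k) := by
  rw [fEvenForm_eq]
  exact h.mul_lineForm (by omega) _ fun v hv => eval_fOddForm_ne_zero n k hv rfl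

theorem IsHyperbolicForm.fOddForm_succ_of_fEvenForm {n k : ℕ} (hn : 1 ≤ n)
    (h : IsHyperbolicForm (2 * n + 2 * k + 2) (fEvenForm n k)) :
    IsHyperbolicForm (2 * n + 2 * (k + 1) + 1) (fOddForm n (k + 1)) := by
  rw [fOddForm_succ]
  exact h.mul_lineForm (by omega) _ fun v hv => eval_fEvenForm_ne_zero n k hv

theorem fEvenForm_one_one_isHyperbolicForm :
    IsHyperbolicForm (2 * 1 + 2 * 1 + 2) (fEvenForm 1 1) := by
  refine ⟨?_, fun v hv => ?_⟩
  · rw [fEvenForm_eq, fOddForm_one]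
    exact ((gForm_isHomogeneous 1).mul (lineForm_isHomogeneous 0)).mul (lineForm_isHomogeneous _)
  · have hf : fEvenForm 1 1 = X 0 ^ 6 - C 2 * X 0 ^ 5 * X 1 - X 0 ^ 2 * X 1 ^ 4
        + C 2 * X 0 * X 1 ^ 5 := by
      simp only [fEvenForm, linesProd, Finset.Icc_self, Finset.prod_singleton, Nat.cast_one,
        one_pow, map_one]
      rw [show (1 : ℝ) + 1 = 2 by norm_num]
      ring
    have hxx : eval v (pderiv 0 (pderiv 0 (fEvenForm 1 1))) =
        30 * v 0 ^ 4 - 40 * v 0 ^ 3 * v 1 - 2 * v 1 ^ 4 := by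
      simp [hf, pderiv_X]
      repeat rw [pderiv_ofNat]
      simp only [map_zero]
      ring
    have hxy : eval v (pderiv 0 (pderiv 1 (fEvenForm 1 1))) =
        -10 * v 0 ^ 4 - 8 * v 0 * v 1 ^ 3 + 10 * v 1 ^ 4 := by
      simp [hf, pderiv_X]
      repeat rw [pderiv_ofNat]
      simp only [map_zero]
      ring
    have hyy : eval v (pderiv 1 (pderiv 1 (fEvenForm 1 1))) =
        -12 * v 0 ^ 2 * v 1 ^ 2 + 40 * v 0 * v 1 ^ 3 := by
      simp [hf, pderiv_X]
      repeat rw [pderiv_ofNat]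
      simp only [map_zero]
      ring
    rw [eval_hessPoly, hxx, hxy, hyy]
    have hv' := ne_zero_coordinate hv
    generalize v 0 = x at *
    generalize v 1 = y at *
    -- This is -1/20 of the Hessian, written as a sum of nonnegative terms.
    have h1 : 0 < x ^ 4 * (5 * (x ^ 2 - 6 / 5 * y ^ 2) ^ 2 + 30 * (x - 19 / 15 * y) ^ 2 * y ^ 2
        + 44 / 3 * y ^ 4) + 2 * (x - y) ^ 2 * y ^ 6 + 3 * y ^ 8 := by
      by_cases hy : y = 0
      · have hx : x ≠ 0 := by simpa [hy] using hv'
        subst hy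
        have : 0 < x ^ 8 := by positivity
        nlinarith
      · positivity
    nlinarith

theorem fOddForm_isHyperbolicForm {n k : ℕ} (hn : 1 ≤ n) (hk : 1 ≤ k) (h : ¬(n = 1 ∧ k = 1)) :
    IsHyperbolicForm (2 * n + 2 * k + 1) (fOddForm n k) := by
  induction k, hk using Nat.le_induction with
  | base =>
    rw [fOddForm_one]
    exact (gForm_isHyperbolicForm n (by omega)).mul_lineForm (by omega) 0
      fun v hv => eval_gForm_ne_zero n hv
  | succ k hk ih =>
    apply IsHyperbolicForm.fOddForm_succ_of_fEvenForm hn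
    -- The induction hypothesis is unavailable exactly at n = k = 1, where the odd form is not
    -- hyperbolic; the sextic replaces it.
    by_cases h1 : n = 1 ∧ k = 1
    · obtain ⟨rfl, rfl⟩ := h1
      exact fEvenForm_one_one_isHyperbolicForm
    · exact (ih h1).fEvenForm_of_fOddForm hn

theorem fEvenForm_isHyperbolicForm {n k : ℕ} (hn : 1 ≤ n) (hk : 1 ≤ k) :
    IsHyperbolicForm (2 * n + 2 * k + 2) (fEvenForm n k) := by
  by_cases h1 : n = 1 ∧ k = 1
  · obtain ⟨rfl, rfl⟩ := h1
    exact fEvenForm_one_one_isHyperbolicForm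
  · exact (fOddForm_isHyperbolicForm hn hk h1).fEvenForm_of_fOddForm hn

theorem mainTheorem3 :
    (∀ n : ℕ, 2 ≤ n →
      IsHyperbolicForm (2 * n + 2) (gForm n) ∧
        HasIndex (secondFormCurve (gForm n)) 0) ∧
    (∀ n k : ℕ, 1 ≤ n → 1 ≤ k → ¬(n = 1 ∧ k = 1) →
      IsHyperbolicForm (2 * n + 2 * k + 1) (fOddForm n k) ∧
        HasIndex (secondFormCurve (fOddForm n k)) (2 - 2 * (k : ℤ) - 1)) ∧
    (∀ n k : ℕ, 1 ≤ n → 1 ≤ k →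
      IsHyperbolicForm (2 * n + 2 * k + 2) (fEvenForm n k) ∧
        HasIndex (secondFormCurve (fEvenForm n k)) (2 - 2 * (k : ℤ) - 2)) := by
  refine ⟨fun n hn => ?_, fun n k hn hk hnk => ?_, fun n k hn hk => ?_⟩
  · have h := gForm_isHyperbolicForm n hn
    exact ⟨h, h.hasIndex (by omega) (gForm_hasWinding n).1⟩
  · have h := fOddForm_isHyperbolicForm hn hk hnk
    refine ⟨h, ?_⟩
    convert h.hasIndex (by omega) (fOddForm_hasWinding n hk).1 using 1
    ring
  · have h := fEvenForm_isHyperbolicForm hn hk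
    refine ⟨h, ?_⟩
    convert h.hasIndex (by omega) (fEvenForm_hasWinding n hk) using 1
    ring
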